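/- **Setting.** Let $\mathcal V$ be a finite nonempty set of agents, split into adversarial agents $\mathcal A$ and normal agents $\mathcal N=\mathcal V\setminus\mathcal A$. Agent $i$ has state $x_i\in\mathbb R^{n_i}$ and input $u_i\in\mathbb R^{m_i}$; $\vec x=(x_i)_{i\in\mathcal V}\in\mathbb R^{\bar n}$ is the joint state. Norms on these spaces are fixed; row vectors carry the operator norm. Agent $i$ has sampling times $0\le t_i^0<t_i^1<\dots\to\infty$ with $t_i^{k+1}-t_i^k=\Gamma_i+\delta_i(k)$, $\Gamma_i>0$, $|\delta_i(k)|\le\delta_i^{\max}$. Put $\Gamma^{\max}=\max_i\Gamma_i$, $\delta^{\max}=\max_i\delta_i^{\max}$, $T=\Gamma^{\max}+2\delta^{\max}$, and assume $t_i^0\le T$. The dynamics are $$\dot x_i(t)=f_i(x_i(t))+g_i(x_i(t))\,u_i^{k}+\phi_i(t),\qquad t\in[t_i^k,t_i^{k+1}),$$ with the input $u_i^k\in\mathcal U_i(\vec x(t_i^k))$ held constant on $[t_i^k,t_i^{k+1})$; on $[0,t_i^0)$ agent $i$ holds some constant input from $\mathcal U_i(\vec x(0))$. Here $\mathcal U_i(\vec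 x)=\{u: A_i(x_i)u\le b_i(x_i)\}$, the maps $f_i,g_i,A_i,b_i,\phi_i$ are locally Lipschitz, and $\|\phi_i(t)\|\le\phi_i^{\max}$ for $t\ge0$. Let $h:\mathbb R^{\bar n}\to\mathbb R$ be $C^1$ with locally Lipschitz gradient, and let $\alpha$ be a locally Lipschitz extended class-$\mathcal K_\infty$ function. The set $S=\{h\le0\}$ is assumed compact, and $\partial S=\{h=0\}$. For every $\vec x\in S$ and every $i$, $\mathcal U_i(\vec x)$ has nonempty interior and is uniformly compact near $\vec x$ (the closure of $\bigcup_{\vec y\in O}\mathcal U_i(\vec y)$ is compact for some neighbourhood $O$ of $\vec x$). Write $L_{f_i}h^{x_i}=\frac{\partial h}{\partial x_i}f_i$, and similarly for $g_i$ and $\phi_i$, and let $$\gamma_i^{\min}(\vec x)=\min_{u\in\mathcal U_i(\vec x)}\big[L_{f_i}h^{x_i}(\vec x)+L_{g_i}h^{x_i}(\vec x)u\big],\qquad \gamma_i^{\max}(\vec x)=\max_{u\in\mathcal U_i(\vec x)}\big[L_{f_i}h^{x_i}(\vec x)+L_{g_i}h^{x_i}(\vec x)u\big].$$ Let $u_i^{\min}(\vec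 x)$ and $u_i^{\max}(\vec x)$ be any minimizer and any maximizer. For $r\ge0$ let $\partial S_r=\{\vec x\in S:\|\vec x-\vec z\|\le r\text{ for some }\vec z\in\partial S\}$. **Constants.** Let $\mathcal W$ consist of all normal agents together with those adversarial agents whose input set $\mathcal U_j(\vec x)$ is not the same for all $\vec x\in S$; thus $\mathcal W=\mathcal N$ if the adversaries' input sets are constant. Let $\mu\ge0$, $L'>0$, $u_{\max}\ge0$ and $c_f,c_g,c_\alpha,c_\gamma,c_h\in\mathbb R$ be any constants such that: * the joint vector $\big(f_i(x_i)+g_i(x_i)u_i+\phi_i(t)\big)_{i\in\mathcal V}$ has norm at most $\mu$ for all $\vec x\in S$, $t\ge0$ and $u_i\in\bigcup_{\vec y\in S}\mathcal U_i(\vec y)$; * $\|u\|\le u_{\max}$ for all $u\in\mathcal U_i(\vec x)$, $\vec x\in S$, $i\in\mathcal W$; * for all $\vec x,\vec y\in S$, the quantities $\sum_{i\in\mathcal W}|L_{f_i}h^{x_i}(\vec x)-L_{f_i}h^{x_i}(\vec y)|$, $\sum_{i\in\mathcal W}\|L_{g_i}h^{x_i}(\vec x)-L_{g_i}h^{x_i}(\vec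 y)\|$, $|\alpha(h(\vec x))-\alpha(h(\vec y))|$ and $\sum_{j\in\mathcal A}|\gamma_j^{\max}(\vec x)-\gamma_j^{\max}(\vec y)|$ are at most $c_f\|\vec x-\vec y\|$, $c_g\|\vec x-\vec y\|$, $c_\alpha\|\vec x-\vec y\|$ and $c_\gamma\|\vec x-\vec y\|$, respectively; * $\big|\sum_{l\in\mathcal V}L_{\phi_l(t)}h^{x_l}(\vec x)\big|\le c_h\sum_{l\in\mathcal V}\phi_l^{\max}$ for all $\vec x\in S$, $t\ge0$. Put $\epsilon(s)=\frac{\mu}{L'}(e^{L's}-1)$, $\eta(s)=(c_f+c_gu_{\max}+c_\alpha+c_\gamma)\,\epsilon(s)+c_h\sum_{l\in\mathcal V}\phi_l^{\max}$ and $\epsilon^*=\epsilon(T)$. **Theorem.** Suppose that for every $\vec x\in\partial S_{2\epsilon^*}$ $$\sum_{i\in\mathcal N}\ \sup_{\vec x^i\in B(\vec x,\epsilon^*)\cap S}\gamma_i^{\min}(\vec x^i)+\sum_{j\in\mathcal A}\gamma_j^{\max}(\vec x)+\alpha(h(\vec x))\le-\eta(\Gamma^{\max}+2\delta^{\max}),$$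 where $B$ denotes the open ball. Consider any trajectory, on any interval $[0,\tau)$, with $\vec x(0)\in S\setminus\partial S_{2\epsilon^*}$, along which every adversarial agent applies $u_j^{\max}(\vec x(t_j^k))$ at all its sampling times and every normal agent applies $u_i^{\min}(\vec x(t_i^k))$ at all its sampling times with $\vec x(t_i^k)\in\partial S_{2\epsilon^*}$ (and otherwise any admissible input). Then $\vec x(t)\in S$ for all $t\in[0,\tau)$; that is, $S$ is forward invariant. -/

import Mathlib

open Set Filter Topology

/-- A group of agents with sampled-data dynamics, together with the safe set function, the set of
adversarial agents and the sampling schedule. `X i` and `U i` are the state and input spaces of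
agent `i` (copies of `ℝ^{n_i}` and `ℝ^{m_i}` with any norms), and `E` is the space of the
concatenated states with the chosen norm; `coords x i` is the block `x_i` of `x`. -/
structure MultiAgentSystem (ι E : Type*) (X U : ι → Type*)
    [NormedAddCommGroup E] [NormedSpace ℝ E]
    [∀ i, NormedAddCommGroup (X i)] [∀ i, NormedSpace ℝ (X i)]
    [∀ i, NormedAddCommGroup (U i)] [∀ i, NormedSpace ℝ (U i)] where
  /-- splitting of the concatenated state into the states of the agents -/
  coords : E ≃L[ℝ] (∀ i, X i)
  /-- drift of each agent -/
  f : ∀ i, X i → X i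
  /-- input matrix of each agent -/
  g : ∀ i, X i → (U i →L[ℝ] X i)
  /-- disturbance of each agent, a function of time -/
  φ : ∀ i, ℝ → X i
  /-- bound on the disturbance of each agent -/
  φmax : ι → ℝ
  /-- number of linear input constraints of each agent -/
  q : ι → ℕ
  /-- matrix of the input constraints `A_i(x_i) u ≤ b_i(x_i)` -/
  A : ∀ i, X i → (U i →L[ℝ] (Fin (q i) → ℝ))
  /-- right-hand side of the input constraints `A_i(x_i) u ≤ b_i(x_i)` -/
  b : ∀ i, X i → (Fin (q i) → ℝ)
  /-- safe set function -/
  h : E → ℝ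
  /-- comparison function applied to `h` -/
  α : ℝ → ℝ
  /-- the adversarial agents; all the other agents are normal -/
  adversarial : Finset ι
  /-- nominal sampling period of each agent -/
  Γ : ι → ℝ
  /-- perturbation of each sampling interval -/
  δ : ι → ℕ → ℝ
  /-- bound on the perturbations of the sampling intervals -/
  δmax : ι → ℝ
  /-- `time i k` is the sampling time of index `k` of agent `i` -/
  time : ι → ℕ → ℝ

/-- Extended class `K_∞` functions. -/
structure IsExtendedClassKInf (α : ℝ → ℝ) : Prop where
  continuous : Continuous α
  strictMono : StrictMono α
  map_zero : α 0 = 0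
  tendsto_atTop : Tendsto α atTop atTop
  tendsto_atBot : Tendsto α atBot atBot

/-- A set-valued map is uniformly compact near `x` if the closure of the union of its values over
some neighbourhood of `x` is compact. -/
def UniformlyCompactNear {E V : Type*} [TopologicalSpace E] [TopologicalSpace V]
    (F : E → Set V) (x : E) : Prop :=
  ∃ O ∈ 𝓝 x, IsCompact (closure (⋃ y ∈ O, F y))

/-- The constants that enter the growth function `ε` and the error bound `η`. -/
structure ErrorConstants where
  μ : ℝ
  L' : ℝ
  cf : ℝ
  cg : ℝ
  cα : ℝ
  cγ : ℝ
  ch : ℝ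
  umax : ℝ

/-- `ε(T) = (μ / L') (exp (L' T) - 1)`. -/
noncomputable def ErrorConstants.eps (c : ErrorConstants) (T : ℝ) : ℝ :=
  c.μ / c.L' * (Real.exp (c.L' * T) - 1)

namespace MultiAgentSystem

variable {ι E : Type*} {X U : ι → Type*}
  [NormedAddCommGroup E] [NormedSpace ℝ E]
  [∀ i, NormedAddCommGroup (X i)] [∀ i, NormedSpace ℝ (X i)]
  [∀ i, NormedAddCommGroup (U i)] [∀ i, NormedSpace ℝ (U i)]

/-- The safe set `S = {h ≤ 0}`. -/
def safeSet (P : MultiAgentSystem ι E X U) : Set E := {x | P.h x ≤ 0}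

/-- The boundary `∂S = {h = 0}`. -/
def safeBoundary (P : MultiAgentSystem ι E X U) : Set E := {x | P.h x = 0}

/-- The inner boundary region `∂S_r`: the points of `S` within distance `r` of `∂S`. -/
def innerStrip (P : MultiAgentSystem ι E X U) (r : ℝ) : Set E :=
  {x | x ∈ P.safeSet ∧ ∃ z ∈ P.safeBoundary, ‖x - z‖ ≤ r}

/-- The input set `U_i = {u | A_i(x_i) u ≤ b_i(x_i)}` at the state `x`. -/
def inputSet (P : MultiAgentSystem ι E X U) (i : ι) (x : E) : Set (U i) :=
  {u | P.A i (P.coords x i) u ≤ P.b i (P.coords x i)}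

/-- The partial derivative `∂h/∂x_i` at `x`, as a linear form on the state space of agent `i`. -/
noncomputable def dh [DecidableEq ι] (P : MultiAgentSystem ι E X U) (i : ι) (x : E) :
    X i →L[ℝ] ℝ :=
  (fderiv ℝ P.h x).comp
    ((P.coords.symm : (∀ i, X i) →L[ℝ] E).comp (ContinuousLinearMap.single ℝ X i))

/-- The partial Lie derivative `L_{f_i} h^{x_i}`. -/
noncomputable def lieF [DecidableEq ι] (P : MultiAgentSystem ι E X U) (i : ι) (x : E) : ℝ :=
  P.dh i x (P.f i (P.coords x i))

/-- The partial Lie derivative `L_{g_i} h^{x_i}`, a row vector. -/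
noncomputable def lieG [DecidableEq ι] (P : MultiAgentSystem ι E X U) (i : ι) (x : E) :
    U i →L[ℝ] ℝ :=
  (P.dh i x).comp (P.g i (P.coords x i))

/-- The partial Lie derivative `L_{φ_i} h^{x_i}` at time `t`. -/
noncomputable def lieφ [DecidableEq ι] (P : MultiAgentSystem ι E X U) (i : ι) (x : E) (t : ℝ) :
    ℝ :=
  P.dh i x (P.φ i t)

/-- `L_{f_i} h^{x_i}(x) + L_{g_i} h^{x_i}(x) u`. -/
noncomputable def contribution [DecidableEq ι] (P : MultiAgentSystem ι E X U) (i : ι) (x : E)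
    (u : U i) : ℝ :=
  P.lieF i x + P.lieG i x u

/-- `γ_i^min`, the minimum of the contribution of agent `i` over its input set. -/
noncomputable def γmin [DecidableEq ι] (P : MultiAgentSystem ι E X U) (i : ι) (x : E) : ℝ :=
  sInf (P.contribution i x '' P.inputSet i x)

/-- `γ_i^max`, the maximum of the contribution of agent `i` over its input set. -/
noncomputable def γmax [DecidableEq ι] (P : MultiAgentSystem ι E X U) (i : ι) (x : E) : ℝ :=
  sSup (P.contribution i x '' P.inputSet i x)

/-- `u` is a possible value of the best-effort input `u_i^min(x)` (a minimizer). -/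
def IsUmin [DecidableEq ι] (P : MultiAgentSystem ι E X U) (i : ι) (x : E) (u : U i) : Prop :=
  u ∈ P.inputSet i x ∧ IsMinOn (P.contribution i x) (P.inputSet i x) u

/-- `u` is a possible value of the worst-case input `u_i^max(x)` (a maximizer). -/
def IsUmax [DecidableEq ι] (P : MultiAgentSystem ι E X U) (i : ι) (x : E) (u : U i) : Prop :=
  u ∈ P.inputSet i x ∧ IsMaxOn (P.contribution i x) (P.inputSet i x) u

/-- `Γ^max + 2 δ^max`. -/
noncomputable def horizon (P : MultiAgentSystem ι E X U) : ℝ :=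
  (⨆ i, P.Γ i) + 2 * ⨆ i, P.δmax i

/-- The standing assumptions on the agents, the safe set and the sampling schedule. -/
structure StandingAssumptions (P : MultiAgentSystem ι E X U) : Prop where
  f_lip : ∀ i, LocallyLipschitz (P.f i)
  g_lip : ∀ i, LocallyLipschitz (P.g i)
  φ_lip : ∀ i, LocallyLipschitz (P.φ i)
  φmax_nonneg : ∀ i, 0 ≤ P.φmax i
  φ_bound : ∀ i, ∀ t, 0 ≤ t → ‖P.φ i t‖ ≤ P.φmax i
  A_lip : ∀ i, LocallyLipschitz (P.A i)
  b_lip : ∀ i, LocallyLipschitz (P.b i)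
  h_contDiff : ContDiff ℝ 1 P.h
  h_grad_lip : LocallyLipschitz (fderiv ℝ P.h)
  α_classK : IsExtendedClassKInf P.α
  α_lip : LocallyLipschitz P.α
  safe_compact : IsCompact P.safeSet
  input_interior : ∀ i, ∀ x ∈ P.safeSet, (interior (P.inputSet i x)).Nonempty
  input_compact : ∀ i, ∀ x ∈ P.safeSet, UniformlyCompactNear (P.inputSet i) x
  Γ_pos : ∀ i, 0 < P.Γ i
  δ_bound : ∀ i k, |P.δ i k| ≤ P.δmax i
  time_succ : ∀ i k, P.time i (k + 1) - P.time i k = P.Γ i + P.δ i k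
  time_lt : ∀ i k, P.time i k < P.time i (k + 1)
  time_tendsto : ∀ i, Tendsto (P.time i) atTop atTop
  time_zero_nonneg : ∀ i, 0 ≤ P.time i 0
  time_zero_le : ∀ i, P.time i 0 ≤ P.horizon

/-- The agents over which the sums defining `c_f` and `c_g` run: the normal agents, and those
adversarial agents (if any) whose input set is not the same at all states of `S`. If the input
sets of the adversarial agents are constant on `S`, these are exactly the normal agents. -/
def errorAgents (P : MultiAgentSystem ι E X U) : Set ι :=
  {i | i ∉ P.adversarial ∨ ∃ x ∈ P.safeSet, ∃ y ∈ P.safeSet, P.inputSet i x ≠ P.inputSet i y}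

open scoped Classical in
/-- The defining properties of the constants: `μ` bounds the speed of the joint state on `S`,
`u_max` bounds the inputs, and the other constants are Lipschitz constants and bounds on `S`. -/
structure IsErrorConstants [Fintype ι] [DecidableEq ι] (P : MultiAgentSystem ι E X U) (c : ErrorConstants) :
    Prop where
  μ_nonneg : 0 ≤ c.μ
  L'_pos : 0 < c.L'
  speed : ∀ x ∈ P.safeSet, ∀ t, 0 ≤ t → ∀ u : ∀ i, U i,
    (∀ i, ∃ y ∈ P.safeSet, u i ∈ P.inputSet i y) →
    ‖P.coords.symm (fun i => P.f i (P.coords x i) + P.g i (P.coords x i) (u i) + P.φ i t)‖ ≤ c.μ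
  umax_nonneg : 0 ≤ c.umax
  umax_bound : ∀ i ∈ P.errorAgents, ∀ x ∈ P.safeSet, ∀ u ∈ P.inputSet i x, ‖u‖ ≤ c.umax
  cf_bound : ∀ x ∈ P.safeSet, ∀ y ∈ P.safeSet,
    ∑ i with i ∈ P.errorAgents, |P.lieF i x - P.lieF i y| ≤ c.cf * ‖x - y‖
  cg_bound : ∀ x ∈ P.safeSet, ∀ y ∈ P.safeSet,
    ∑ i with i ∈ P.errorAgents, ‖P.lieG i x - P.lieG i y‖ ≤ c.cg * ‖x - y‖
  cα_bound : ∀ x ∈ P.safeSet, ∀ y ∈ P.safeSet,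
    |P.α (P.h x) - P.α (P.h y)| ≤ c.cα * ‖x - y‖
  cγ_bound : ∀ x ∈ P.safeSet, ∀ y ∈ P.safeSet,
    ∑ j ∈ P.adversarial, |P.γmax j x - P.γmax j y| ≤ c.cγ * ‖x - y‖
  ch_bound : ∀ x ∈ P.safeSet, ∀ t, 0 ≤ t →
    |∑ l, P.lieφ l x t| ≤ c.ch * ∑ l, P.φmax l

/-- `η(T) = (c_f + c_g u_max + c_α + c_γ) ε(T) + c_h ∑ φ_l^max`. -/
noncomputable def η [Fintype ι] (P : MultiAgentSystem ι E X U) (c : ErrorConstants) (T : ℝ) : ℝ :=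
  (c.cf + c.cg * c.umax + c.cα + c.cγ) * c.eps T + c.ch * ∑ l, P.φmax l

/-- `x` is a trajectory on `[0, τ)` of the sampled-data dynamics with zero-order hold. Agent `i`
holds the input `u i k` on `[time i k, time i (k+1))`, and some input `u₀ i` that is admissible
at the initial state until its first sampling time. Since the inputs are piecewise constant, the
derivative is the one from the right. -/
structure IsTrajectory (P : MultiAgentSystem ι E X U) (τ : ℝ) (x : ℝ → E)
    (u₀ : ∀ i, U i) (u : ∀ i, ℕ → U i) : Prop where
  continuousOn : ContinuousOn x (Ico 0 τ)
  init_mem : ∀ i, u₀ i ∈ P.inputSet i (x 0)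
  input_mem : ∀ i k, P.time i k < τ → u i k ∈ P.inputSet i (x (P.time i k))
  deriv_init : ∀ i, ∀ t, 0 ≤ t → t < P.time i 0 → t < τ →
    HasDerivWithinAt (fun s => P.coords (x s) i)
      (P.f i (P.coords (x t) i) + P.g i (P.coords (x t) i) (u₀ i) + P.φ i t) (Ici t) t
  deriv_step : ∀ i k, ∀ t, P.time i k ≤ t → t < P.time i (k + 1) → t < τ →
    HasDerivWithinAt (fun s => P.coords (x s) i)
      (P.f i (P.coords (x t) i) + P.g i (P.coords (x t) i) (u i k) + P.φ i t) (Ici t) t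

/-- Every adversarial agent applies `u_j^max` at all its sampling times. -/
def AdversariesMaximize [DecidableEq ι] (P : MultiAgentSystem ι E X U) (τ : ℝ) (x : ℝ → E)
    (u : ∀ i, ℕ → U i) : Prop :=
  ∀ j ∈ P.adversarial, ∀ k, P.time j k < τ → P.IsUmax j (x (P.time j k)) (u j k)

/-- Every normal agent applies `u_i^min` at all sampled states that lie in `D`. -/
def NormalAgentsMinimizeOn [DecidableEq ι] (P : MultiAgentSystem ι E X U) (D : Set E) (τ : ℝ)
    (x : ℝ → E) (u : ∀ i, ℕ → U i) : Prop :=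
  ∀ i ∉ P.adversarial, ∀ k, P.time i k < τ → x (P.time i k) ∈ D →
    P.IsUmin i (x (P.time i k)) (u i k)

end MultiAgentSystem

/-! Write `T` for the horizon and suppose `h` vanishes along the trajectory, first at time `t₁`. Up
to `t₁` the state stays in `S` and moves at speed at most `μ`, and `μ T ≤ ε*`. Starting farther than
`2 ε*` from the boundary therefore forces `t₁ > 2T`, and the state lies in the strip of width `2 ε*`
throughout `[t₁ - 2T, t₁]`. On `[t₁ - T, t₁)` every held input was sampled less than `T` earlier,
hence inside the strip, so normal agents are minimizing and adversaries maximizing. Replacing the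
sampled states by the current one costs at most the error terms of `η`, so the hypothesis makes the
right derivative of `h` nonpositive there. This contradicts `h < 0` at `t₁ - T` and `h = 0` at `t₁`.

The delicate point is asynchrony: the Lipschitz constants bound sums over agents between two common
states, while each agent has its own sampling time. `sum_dist_le_of_sum_dist_le` handles this,
`sum_contribution_le` compares inputs at sampled and current states, and `IsTrajectory.h_ne_zero`
gives the contradiction. -/

/-- Errors accumulated over different starting times along one curve add up to no more than the
error accumulated over the longest of the intervals. -/
theorem sum_dist_le_of_sum_dist_le {ι : Type*} [DecidableEq ι] {M : ι → Type*}
    [∀ i, PseudoMetricSpace (M i)] (G : ∀ i, ℝ → M i) (C t₀ t₁ : ℝ) (S : Finset ι)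
    (hG : ∀ a b, t₀ ≤ a → a ≤ b → b ≤ t₁ → ∑ i ∈ S, dist (G i b) (G i a) ≤ C * (b - a))
    (σ : ι → ℝ) (t : ℝ) (ht : t ≤ t₁) (hσ : ∀ i ∈ S, t₀ ≤ σ i ∧ σ i ≤ t) (h0 : t₀ ≤ t) :
    ∑ i ∈ S, dist (G i t) (G i (σ i)) ≤ C * (t - t₀) := by
  suffices H : ∀ s : Finset ι, s ⊆ S → ∀ t, t₀ ≤ t → t ≤ t₁ → (∀ i ∈ s, σ i ≤ t) →
      ∑ i ∈ s, dist (G i t) (G i (σ i)) ≤ C * (t - t₀) from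
    H S subset_rfl t h0 ht fun i hi => (hσ i hi).2
  intro s
  induction s using Finset.induction_on_max_value σ with
  | empty =>
    intro _ t h0 ht _
    -- No sign of `C` is assumed; `hG` itself forces `C * (t - t₀)` to be nonnegative.
    simpa using (Finset.sum_nonneg fun i _ => dist_nonneg).trans (hG t₀ t le_rfl h0 ht)
  | insert a s ha hmax ih =>
    intro hs t h0 ht hle
    have haS : a ∈ S := hs (Finset.mem_insert_self a s)
    have hat : σ a ≤ t := hle a (Finset.mem_insert_self a s)
    -- `a` has the latest start: before `σ a` only the agents of `s` accumulate error, and after it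
    -- all agents share one interval, where `hG` applies.
    have h1 := ih ((Finset.subset_insert a s).trans hs) (σ a) (hσ a haS).1 (hat.trans ht) hmax
    have h2 : ∑ i ∈ insert a s, dist (G i t) (G i (σ a)) ≤ C * (t - σ a) :=
      (Finset.sum_le_sum_of_subset_of_nonneg hs fun _ _ _ => dist_nonneg).trans
        (hG (σ a) t (hσ a haS).1 hat ht)
    have h3 : ∑ i ∈ s, dist (G i t) (G i (σ i)) ≤
        ∑ i ∈ s, dist (G i t) (G i (σ a)) + ∑ i ∈ s, dist (G i (σ a)) (G i (σ i)) := by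
      rw [← Finset.sum_add_distrib]
      exact Finset.sum_le_sum fun i _ => dist_triangle _ _ _
    rw [Finset.sum_insert ha] at h2 ⊢
    linarith

/-- From `y ≤ exp y - 1`. This linear lower bound is all the proof needs of `eps`. -/
theorem ErrorConstants.mul_le_eps (c : ErrorConstants) (hμ : 0 ≤ c.μ) (hL : 0 < c.L') (s : ℝ) :
    c.μ * s ≤ c.eps s := by
  have h := Real.add_one_le_exp (c.L' * s)
  calc c.μ * s = c.μ / c.L' * (c.L' * s) := by field_simp
    _ ≤ c.eps s := mul_le_mul_of_nonneg_left (by linarith) (by positivity)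

namespace MultiAgentSystem

variable {ι E : Type*} {X U : ι → Type*}
  [NormedAddCommGroup E] [NormedSpace ℝ E]
  [∀ i, NormedAddCommGroup (X i)] [∀ i, NormedSpace ℝ (X i)]
  [∀ i, NormedAddCommGroup (U i)] [∀ i, NormedSpace ℝ (U i)]
  {P : MultiAgentSystem ι E X U}

/-! ### The sampling schedule. -/

theorem StandingAssumptions.δmax_nonneg (hP : P.StandingAssumptions) (i : ι) : 0 ≤ P.δmax i :=
  (abs_nonneg _).trans (hP.δ_bound i 0)

theorem StandingAssumptions.add_δmax_le_horizon [Finite ι] (hP : P.StandingAssumptions) (i : ι) :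
    P.Γ i + P.δmax i ≤ P.horizon := by
  have h1 : P.Γ i ≤ ⨆ i, P.Γ i := le_ciSup (Set.finite_range _).bddAbove i
  have h2 : P.δmax i ≤ ⨆ i, P.δmax i := le_ciSup (Set.finite_range _).bddAbove i
  have h3 := hP.δmax_nonneg i
  unfold horizon
  linarith

theorem StandingAssumptions.horizon_pos [Finite ι] [Nonempty ι] (hP : P.StandingAssumptions) :
    0 < P.horizon := by
  obtain ⟨i⟩ := ‹Nonempty ι›
  linarith [hP.add_δmax_le_horizon i, hP.Γ_pos i, hP.δmax_nonneg i]

theorem StandingAssumptions.time_succ_le [Finite ι] (hP : P.StandingAssumptions) (i : ι) (k : ℕ) :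
    P.time i (k + 1) ≤ P.time i k + P.horizon := by
  linarith [hP.add_δmax_le_horizon i, hP.time_succ i k, le_of_abs_le (hP.δ_bound i k)]

theorem StandingAssumptions.time_nonneg (hP : P.StandingAssumptions) (i : ι) (k : ℕ) :
    0 ≤ P.time i k :=
  (hP.time_zero_nonneg i).trans
    ((strictMono_nat_of_lt_succ (hP.time_lt i)).monotone (Nat.zero_le k))

theorem StandingAssumptions.exists_sample (hP : P.StandingAssumptions) (i : ι) {t : ℝ}
    (ht : P.time i 0 ≤ t) : ∃ k, P.time i k ≤ t ∧ t < P.time i (k + 1) := by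
  classical
  have hex : ∃ k, t < P.time i k := ((hP.time_tendsto i).eventually_gt_atTop t).exists
  obtain ⟨k, hk⟩ := Nat.exists_eq_succ_of_ne_zero (n := Nat.find hex) fun h0 => by
    have := Nat.find_spec hex
    rw [h0] at this
    exact this.not_ge ht
  refine ⟨k, not_lt.1 (Nat.find_min hex (by omega)), ?_⟩
  have := Nat.find_spec hex
  rwa [hk] at this

/-! ### Speed of the trajectory inside the safe set. -/

/-- The state assembled from the derivatives of the blocks is the derivative of the state. -/
theorem hasDerivWithinAt_of_coords [Fintype ι] {x : ℝ → E} {v : ∀ i, X i} {s : Set ℝ} {t : ℝ}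
    (h : ∀ i, HasDerivWithinAt (fun r => P.coords (x r) i) (v i) s t) :
    HasDerivWithinAt x (P.coords.symm v) s t := by
  have h1 : HasDerivWithinAt (fun r => P.coords (x r)) v s t := hasDerivWithinAt_pi.2 h
  have h2 := P.coords.symm.hasFDerivAt.comp_hasDerivWithinAt t h1
  simpa [Function.comp_def] using h2

/-- Every input held before `t₁` was admissible at some earlier safe state, so `speed` bounds the
right derivative; the mean value inequality does the rest. -/
theorem IsTrajectory.norm_sub_le [Fintype ι] [DecidableEq ι] (hP : P.StandingAssumptions)
    {c : ErrorConstants} (hc : P.IsErrorConstants c) {τ : ℝ} {x : ℝ → E} {u₀ : ∀ i, U i}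
    {u : ∀ i, ℕ → U i} (hx : P.IsTrajectory τ x u₀ u) {t₁ : ℝ} (ht₁ : t₁ < τ)
    (hS : ∀ t, 0 ≤ t → t ≤ t₁ → x t ∈ P.safeSet) {a b : ℝ} (ha : 0 ≤ a) (hab : a ≤ b)
    (hb : b ≤ t₁) : ‖x b - x a‖ ≤ c.μ * (b - a) := by
  have hinput : ∀ t, 0 ≤ t → t < b → ∀ i, ∃ w : U i, (∃ y ∈ P.safeSet, w ∈ P.inputSet i y) ∧
      HasDerivWithinAt (fun s => P.coords (x s) i)
        (P.f i (P.coords (x t) i) + P.g i (P.coords (x t) i) w + P.φ i t) (Ici t) t := by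
    intro t ht0 htb i
    rcases lt_or_ge t (P.time i 0) with h | h
    · exact ⟨u₀ i, ⟨x 0, hS 0 le_rfl (by linarith), hx.init_mem i⟩,
        hx.deriv_init i t ht0 h (by linarith)⟩
    · obtain ⟨k, hk, hk'⟩ := hP.exists_sample i h
      exact ⟨u i k, ⟨x (P.time i k), hS _ (hP.time_nonneg i k) (by linarith),
        hx.input_mem i k (by linarith)⟩, hx.deriv_step i k t hk hk' (by linarith)⟩
  choose! w hw hderiv using hinput
  refine norm_image_sub_le_of_norm_deriv_right_le_segment
    (f' := fun t => P.coords.symm fun i =>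
      P.f i (P.coords (x t) i) + P.g i (P.coords (x t) i) (w t i) + P.φ i t)
    (hx.continuousOn.mono fun t ht => ⟨ha.trans ht.1, by linarith [ht.2]⟩)
    (fun t ht => hasDerivWithinAt_of_coords fun i => hderiv t (ha.trans ht.1) ht.2 i)
    (fun t ht => ?_) b (right_mem_Icc.2 hab)
  exact hc.speed (x t) (hS t (ha.trans ht.1) (by linarith [ht.2])) t (ha.trans ht.1) (w t)
    (hw t (ha.trans ht.1) ht.2)

theorem StandingAssumptions.isBounded_inputSet (hP : P.StandingAssumptions) (i : ι) {y : E}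
    (hy : y ∈ P.safeSet) : Bornology.IsBounded (P.inputSet i y) := by
  obtain ⟨O, hO, hK⟩ := hP.input_compact i y hy
  exact hK.isBounded.subset
    ((subset_biUnion_of_mem (u := fun y => P.inputSet i y) (mem_of_mem_nhds hO)).trans
      subset_closure)

/-! ### Contributions of the agents to the derivative of `h`. -/

section

variable [DecidableEq ι]

/-- The derivative of `h` along a velocity splits into the contributions of the agents. -/
theorem fderiv_h_apply [Fintype ι] (y : E) (t : ℝ) (w : ∀ i, U i) :
    fderiv ℝ P.h y (P.coords.symm fun i =>
        P.f i (P.coords y i) + P.g i (P.coords y i) (w i) + P.φ i t) =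
      ∑ i, P.contribution i y (w i) + ∑ i, P.lieφ i y t := by
  set v : ∀ i, X i := fun i => P.f i (P.coords y i) + P.g i (P.coords y i) (w i) + P.φ i t
  have hv : v = ∑ i, Pi.single i (v i) := (Finset.univ_sum_single v).symm
  rw [hv, map_sum, map_sum, ← Finset.sum_add_distrib]
  refine Finset.sum_congr rfl fun i _ => ?_
  have : fderiv ℝ P.h y (P.coords.symm (Pi.single i (v i))) = P.dh i y (v i) := rfl
  rw [this]
  simp [v, contribution, lieF, lieG, lieφ]

theorem contribution_le (i : ι) (y z : E) (w : U i) {B : ℝ} (hw : ‖w‖ ≤ B) :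
    P.contribution i y w ≤
      P.contribution i z w + (|P.lieF i y - P.lieF i z| + ‖P.lieG i y - P.lieG i z‖ * B) := by
  have h1 := le_abs_self (P.lieF i y - P.lieF i z)
  have h2 : P.lieG i y w - P.lieG i z w ≤ ‖P.lieG i y - P.lieG i z‖ * B :=
    (le_abs_self _).trans (((P.lieG i y - P.lieG i z).le_opNorm w).trans
      (mul_le_mul_of_nonneg_left hw (norm_nonneg _)))
  unfold contribution
  linarith

theorem StandingAssumptions.isBounded_image_contribution (hP : P.StandingAssumptions) (i : ι)
    {y : E} (hy : y ∈ P.safeSet) :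
    Bornology.IsBounded (P.contribution i y '' P.inputSet i y) := by
  have h := (P.lieG i y).lipschitz.isBounded_image (hP.isBounded_inputSet i hy)
  have h2 := (isometry_add_left (P.lieF i y)).lipschitz.isBounded_image h
  rwa [image_image] at h2

theorem StandingAssumptions.contribution_le_γmax (hP : P.StandingAssumptions) (i : ι) {y : E}
    (hy : y ∈ P.safeSet) {w : U i} (hw : w ∈ P.inputSet i y) : P.contribution i y w ≤ P.γmax i y :=
  le_csSup (hP.isBounded_image_contribution i hy).bddAbove (mem_image_of_mem _ hw)

theorem StandingAssumptions.γmin_le_contribution (hP : P.StandingAssumptions) (i : ι) {y : E}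
    (hy : y ∈ P.safeSet) {w : U i} (hw : w ∈ P.inputSet i y) : P.γmin i y ≤ P.contribution i y w :=
  csInf_le (hP.isBounded_image_contribution i hy).bddBelow (mem_image_of_mem _ hw)

theorem IsUmin.contribution_le_γmin {i : ι} {y : E} {w : U i} (hw : P.IsUmin i y w) :
    P.contribution i y w ≤ P.γmin i y :=
  le_csInf ⟨_, mem_image_of_mem _ hw.1⟩ (forall_mem_image.2 fun _ hv => hw.2 hv)

variable [Fintype ι] {c : ErrorConstants}

theorem IsErrorConstants.abs_lieF_sub_le (hc : P.IsErrorConstants c) {i : ι}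
    (hi : i ∈ P.errorAgents) {y z : E} (hy : y ∈ P.safeSet) (hz : z ∈ P.safeSet) :
    |P.lieF i y - P.lieF i z| ≤ c.cf * ‖y - z‖ := by
  classical
  refine le_trans ?_ (hc.cf_bound y hy z hz)
  exact Finset.single_le_sum (f := fun i => |P.lieF i y - P.lieF i z|)
    (fun _ _ => abs_nonneg _) (by simpa using hi)

theorem IsErrorConstants.norm_lieG_sub_le (hc : P.IsErrorConstants c) {i : ι}
    (hi : i ∈ P.errorAgents) {y z : E} (hy : y ∈ P.safeSet) (hz : z ∈ P.safeSet) :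
    ‖P.lieG i y - P.lieG i z‖ ≤ c.cg * ‖y - z‖ := by
  classical
  refine le_trans ?_ (hc.cg_bound y hy z hz)
  exact Finset.single_le_sum (f := fun i => ‖P.lieG i y - P.lieG i z‖)
    (fun _ _ => norm_nonneg _) (by simpa using hi)

/-- The minimal contribution of a normal agent is bounded above near a state of `S`. -/
theorem IsErrorConstants.bddAbove_γmin (hP : P.StandingAssumptions) (hc : P.IsErrorConstants c)
    {i : ι} (hi : i ∈ P.errorAgents) {y : E} (hy : y ∈ P.safeSet) (r : ℝ) :
    BddAbove (P.γmin i '' (Metric.ball y r ∩ P.safeSet)) := by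
  refine ⟨P.lieF i y + ‖P.lieG i y‖ * c.umax + (|c.cf| * r + |c.cg| * r * c.umax),
    forall_mem_image.2 ?_⟩
  rintro z ⟨hzr, hz⟩
  rw [Metric.mem_ball, dist_eq_norm] at hzr
  obtain ⟨w, hw⟩ := hP.input_interior i z hz
  have hw := interior_subset hw
  have hwB := hc.umax_bound i hi z hz w hw
  have h1 := hP.γmin_le_contribution i hz hw
  have h2 := contribution_le (P := P) i z y w hwB
  have key : ∀ k : ℝ, k * ‖z - y‖ ≤ |k| * r := fun k =>
    mul_le_mul (le_abs_self k) hzr.le (norm_nonneg _) (abs_nonneg k)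
  have h3 := (hc.abs_lieF_sub_le hi hz hy).trans (key _)
  have h4 := mul_le_mul_of_nonneg_right ((hc.norm_lieG_sub_le hi hz hy).trans (key _))
    hc.umax_nonneg
  have h5 : P.lieG i y w ≤ ‖P.lieG i y‖ * c.umax :=
    (le_abs_self _).trans (((P.lieG i y).le_opNorm w).trans
      (mul_le_mul_of_nonneg_left hwB (norm_nonneg _)))
  have h6 : P.contribution i y w = P.lieF i y + P.lieG i y w := rfl
  linarith

open scoped Classical in
/-- At a safe state `y`, the inputs computed at earlier safe states `z i` contribute at most the
bound at `y` up to the sampling errors. -/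
theorem sum_contribution_le (hP : P.StandingAssumptions) (hc : P.IsErrorConstants c) {y : E}
    (hy : y ∈ P.safeSet) {r : ℝ} (z : ι → E) (hz : ∀ i, z i ∈ P.safeSet)
    (hzr : ∀ i, ‖z i - y‖ < r) (w : ∀ i, U i)
    (hmax : ∀ i ∈ P.adversarial, P.IsUmax i (z i) (w i))
    (hmin : ∀ i ∉ P.adversarial, P.IsUmin i (z i) (w i)) :
    ∑ i, P.contribution i y (w i) ≤
      ∑ i ∈ P.adversarialᶜ, sSup (P.γmin i '' (Metric.ball y r ∩ P.safeSet))
        + ∑ j ∈ P.adversarial, P.γmax j y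
        + (∑ i with i ∈ P.errorAgents, |P.lieF i y - P.lieF i (z i)|
          + (∑ i with i ∈ P.errorAgents, ‖P.lieG i y - P.lieG i (z i)‖) * c.umax
          + ∑ j ∈ P.adversarial, |P.γmax j y - P.γmax j (z j)|) := by
  -- Extending by zero off `errorAgents` lets the normal and adversarial sums recombine into a
  -- single sum over all agents.
  set e : ι → ℝ := fun i => if i ∈ P.errorAgents then
    |P.lieF i y - P.lieF i (z i)| + ‖P.lieG i y - P.lieG i (z i)‖ * c.umax else 0 with he
  have hnormal : ∀ i ∈ P.adversarialᶜ, P.contribution i y (w i) ≤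
      sSup (P.γmin i '' (Metric.ball y r ∩ P.safeSet)) + e i := by
    intro i hi
    rw [Finset.mem_compl] at hi
    have hiW : i ∈ P.errorAgents := Or.inl hi
    have h1 := contribution_le (P := P) i y (z i) (w i)
      (hc.umax_bound i hiW (z i) (hz i) (w i) (hmin i hi).1)
    have h2 := (hmin i hi).contribution_le_γmin
    have h3 : P.γmin i (z i) ≤ sSup (P.γmin i '' (Metric.ball y r ∩ P.safeSet)) :=
      -- Boundedness is essential: a real `sSup` of a set unbounded above is `0`.
      le_csSup (hc.bddAbove_γmin hP hiW hy r)
        (mem_image_of_mem _ ⟨by simpa [dist_eq_norm] using hzr i, hz i⟩)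
    simp only [he, if_pos hiW]
    linarith
  have hadv : ∀ i ∈ P.adversarial, P.contribution i y (w i) ≤
      P.γmax i y + |P.γmax i y - P.γmax i (z i)| + e i := by
    intro i hi
    by_cases hiW : i ∈ P.errorAgents
    · have h1 := contribution_le (P := P) i y (z i) (w i)
        (hc.umax_bound i hiW (z i) (hz i) (w i) (hmax i hi).1)
      have h2 := hP.contribution_le_γmax i (hz i) (hmax i hi).1
      have h3 := neg_abs_le (P.γmax i y - P.γmax i (z i))
      simp only [he, if_pos hiW]
      linarith
    -- With a constant input set the held input is still admissible at `y`, so `γmax` at `y` bounds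
    -- it without any Lie derivative error.
    · have heq : P.inputSet i (z i) = P.inputSet i y := by
        by_contra hne
        exact hiW (Or.inr ⟨z i, hz i, y, hy, hne⟩)
      have h1 := hP.contribution_le_γmax i hy (heq ▸ (hmax i hi).1)
      simp only [he, if_neg hiW]
      linarith [abs_nonneg (P.γmax i y - P.γmax i (z i))]
  have h1 := Finset.sum_le_sum hnormal
  have h2 := Finset.sum_le_sum hadv
  rw [Finset.sum_add_distrib] at h1
  rw [Finset.sum_add_distrib, Finset.sum_add_distrib] at h2
  have h3 : ∑ i, e i = ∑ i with i ∈ P.errorAgents, |P.lieF i y - P.lieF i (z i)|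
      + (∑ i with i ∈ P.errorAgents, ‖P.lieG i y - P.lieG i (z i)‖) * c.umax := by
    rw [Finset.sum_mul, ← Finset.sum_add_distrib, Finset.sum_filter]
  have h4 := Finset.sum_add_sum_compl P.adversarial e
  have h5 := Finset.sum_add_sum_compl P.adversarial fun i => P.contribution i y (w i)
  linarith

end

/-! ### Contradiction at the first time the boundary is reached. -/

/-- A trajectory that reaches the boundary of `S` only at time `t₁` cannot have started farther
than `2 ε*` away from it. -/
theorem IsTrajectory.h_ne_zero [Fintype ι] [DecidableEq ι] [Nonempty ι]
    (hP : P.StandingAssumptions) {c : ErrorConstants} (hc : P.IsErrorConstants c)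
    (hcond : ∀ x ∈ P.innerStrip (2 * c.eps P.horizon),
      ∑ i ∈ P.adversarialᶜ, sSup (P.γmin i '' (Metric.ball x (c.eps P.horizon) ∩ P.safeSet))
        + ∑ j ∈ P.adversarial, P.γmax j x + P.α (P.h x) ≤ - P.η c P.horizon)
    {τ : ℝ} {x : ℝ → E} {u₀ : ∀ i, U i} {u : ∀ i, ℕ → U i} (hx : P.IsTrajectory τ x u₀ u)
    (hmax : P.AdversariesMaximize τ x u)
    (hmin : P.NormalAgentsMinimizeOn (P.innerStrip (2 * c.eps P.horizon)) τ x u)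
    (h0 : x 0 ∉ P.innerStrip (2 * c.eps P.horizon)) {t₁ : ℝ} (ht₁0 : 0 ≤ t₁) (ht₁ : t₁ < τ)
    (hneg : ∀ t, 0 ≤ t → t < t₁ → P.h (x t) < 0) : P.h (x t₁) ≠ 0 := by
  classical
  intro hzero
  set T := P.horizon with hT
  have hTpos : 0 < T := hP.horizon_pos
  have hμT : c.μ * T ≤ c.eps T := c.mul_le_eps hc.μ_nonneg hc.L'_pos T
  have hS : ∀ t, 0 ≤ t → t ≤ t₁ → x t ∈ P.safeSet := fun t ht ht' => by
    rcases ht'.lt_or_eq with h | h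
    · exact (hneg t ht h).le
    · exact (h ▸ hzero).le
  have hlip : ∀ {a b : ℝ}, 0 ≤ a → a ≤ b → b ≤ t₁ → ‖x b - x a‖ ≤ c.μ * (b - a) :=
    fun ha hab hb => hx.norm_sub_le hP hc ht₁ hS ha hab hb
  have hfar : 2 * c.eps T < ‖x t₁ - x 0‖ := by
    by_contra! h
    exact h0 ⟨hS 0 le_rfl ht₁0, x t₁, hzero, by rwa [norm_sub_rev]⟩
  have hfar' := hfar.trans_le (hlip le_rfl ht₁0 le_rfl)
  -- If `μ` were zero the state could not have moved. Positivity also yields the strict inequality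
  -- required by the open ball.
  have hμ : 0 < c.μ := hc.μ_nonneg.lt_of_ne fun h => by
    rw [← h] at hfar' hμT
    linarith
  have h2T : 2 * T < t₁ := by
    have : c.μ * (2 * T) < c.μ * (t₁ - 0) := by linarith
    linarith [lt_of_mul_lt_mul_left this hμ.le]
  have hpos : 0 < ‖x t₁ - x 0‖ := by
    linarith [mul_pos hμ hTpos]
  have hS0 := hS 0 le_rfl ht₁0
  have hS1 := hS t₁ ht₁0 le_rfl
  -- The signs of the constants are not assumed; they follow from the bounds at two distinct safe
  -- states.
  have hcf : 0 ≤ c.cf := nonneg_of_mul_nonneg_left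
    ((Finset.sum_nonneg fun _ _ => abs_nonneg _).trans (hc.cf_bound _ hS1 _ hS0)) hpos
  have hcg : 0 ≤ c.cg := nonneg_of_mul_nonneg_left
    ((Finset.sum_nonneg fun _ _ => norm_nonneg _).trans (hc.cg_bound _ hS1 _ hS0)) hpos
  have hcα : 0 ≤ c.cα := nonneg_of_mul_nonneg_left
    ((abs_nonneg _).trans (hc.cα_bound _ hS1 _ hS0)) hpos
  have hcγ : 0 ≤ c.cγ := nonneg_of_mul_nonneg_left
    ((Finset.sum_nonneg fun _ _ => abs_nonneg _).trans (hc.cγ_bound _ hS1 _ hS0)) hpos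
  have hstrip : ∀ t, t₁ - 2 * T ≤ t → t ≤ t₁ → x t ∈ P.innerStrip (2 * c.eps T) := by
    intro t ht ht'
    refine ⟨hS t (by linarith) ht', x t₁, hzero, ?_⟩
    rw [norm_sub_rev]
    have := mul_le_mul_of_nonneg_left (show t₁ - t ≤ 2 * T by linarith) hμ.le
    linarith [hlip (show 0 ≤ t by linarith) ht' le_rfl]
  -- Here `t ≥ t₁ - T > T`, so every agent has already sampled at least once.
  have hsample : ∀ t, t₁ - T ≤ t → ∀ i, ∃ k, P.time i k ≤ t ∧ t < P.time i (k + 1) :=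
    fun t ht i => hP.exists_sample i (by linarith [hP.time_zero_le i])
  choose! k hk hk' using hsample
  have hkT : ∀ t, t₁ - T ≤ t → ∀ i, t - T < P.time i (k t i) := fun t ht i => by
    linarith [hk' t ht i, hP.time_succ_le i (k t i)]
  have hcont : ContinuousOn (fun t => P.h (x t)) (Icc (t₁ - T) t₁) :=
    hP.h_contDiff.continuous.comp_continuousOn
      (hx.continuousOn.mono fun t ht => ⟨by linarith [ht.1], by linarith [ht.2]⟩)
  have hderiv : ∀ t ∈ Ico (t₁ - T) t₁, HasDerivWithinAt (fun s => P.h (x s))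
      (∑ i, P.contribution i (x t) (u i (k t i)) + ∑ i, P.lieφ i (x t) t) (Ici t) t := by
    rintro t ⟨ht, ht'⟩
    have h1 : HasDerivWithinAt x _ (Ici t) t := hasDerivWithinAt_of_coords fun i =>
      hx.deriv_step i (k t i) t (hk t ht i) (hk' t ht i) (by linarith)
    have h2 := ((hP.h_contDiff.differentiable (by simp)) (x t)).hasFDerivAt.comp_hasDerivWithinAt
      t h1
    rwa [fderiv_h_apply (x t) t fun i => u i (k t i)] at h2
  have hle : ∀ t ∈ Ico (t₁ - T) t₁,
      ∑ i, P.contribution i (x t) (u i (k t i)) + ∑ i, P.lieφ i (x t) t ≤ 0 := by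
    rintro t ⟨ht, ht'⟩
    have ht0 : 0 ≤ t := by linarith
    have hσ : ∀ i, t - T ≤ P.time i (k t i) ∧ P.time i (k t i) ≤ t :=
      fun i => ⟨(hkT t ht i).le, hk t ht i⟩
    have hσ0 : ∀ i, 0 ≤ P.time i (k t i) := fun i => hP.time_nonneg i _
    have hsum := sum_contribution_le hP hc (hS t ht0 ht'.le) (r := c.eps T)
      (fun i => x (P.time i (k t i))) (fun i => hS _ (hσ0 i) (by linarith [hk t ht i]))
      (fun i => by
        rw [norm_sub_rev]
        have := mul_lt_mul_of_pos_left (show t - P.time i (k t i) < T by linarith [hkT t ht i]) hμ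
        linarith [hlip (hσ0 i) (hk t ht i) ht'.le])
      (fun i => u i (k t i))
      (fun i hi => hmax i hi _ (by linarith [hk t ht i]))
      (fun i hi => hmin i hi _ (by linarith [hk t ht i])
        (hstrip _ (by linarith [hkT t ht i]) (by linarith [hk t ht i])))
    have hstep : ∀ {C a b : ℝ}, 0 ≤ C → t - T ≤ a → a ≤ b → b ≤ t →
        C * ‖x b - x a‖ ≤ C * c.μ * (b - a) := fun hC ha hab hb => by
      rw [mul_assoc]
      exact mul_le_mul_of_nonneg_left (hlip (by linarith) hab (by linarith)) hC
    have hmem : ∀ s, t - T ≤ s → s ≤ t → x s ∈ P.safeSet := fun s hs hs' =>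
      hS s (by linarith) (by linarith)
    have hend : ∀ {C : ℝ}, 0 ≤ C → C * c.μ * (t - (t - T)) ≤ C * c.eps T := fun hC => by
      rw [sub_sub_cancel, mul_assoc]
      exact mul_le_mul_of_nonneg_left hμT hC
    have hF : ∑ i with i ∈ P.errorAgents, |P.lieF i (x t) - P.lieF i (x (P.time i (k t i)))| ≤
        c.cf * c.eps T :=
      (sum_dist_le_of_sum_dist_le (fun i s => P.lieF i (x s)) (c.cf * c.μ) (t - T) t _
        (fun a b ha hab hb => (hc.cf_bound _ (hmem b (by linarith) hb) _
          (hmem a ha (by linarith))).trans (hstep hcf ha hab hb))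
        (fun i => P.time i (k t i)) t le_rfl (fun i _ => hσ i) (by linarith)).trans (hend hcf)
    have hG : ∑ i with i ∈ P.errorAgents, ‖P.lieG i (x t) - P.lieG i (x (P.time i (k t i)))‖ ≤
        c.cg * c.eps T := by
      have h := (sum_dist_le_of_sum_dist_le (fun i s => P.lieG i (x s)) (c.cg * c.μ) (t - T) t
        (Finset.univ.filter fun i => i ∈ P.errorAgents)
        (fun a b ha hab hb => by
          simp only [dist_eq_norm]
          exact (hc.cg_bound _ (hmem b (by linarith) hb) _
            (hmem a ha (by linarith))).trans (hstep hcg ha hab hb))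
        (fun i => P.time i (k t i)) t le_rfl (fun i _ => hσ i) (by linarith)).trans (hend hcg)
      simpa only [dist_eq_norm] using h
    have hγ : ∑ j ∈ P.adversarial, |P.γmax j (x t) - P.γmax j (x (P.time j (k t j)))| ≤
        c.cγ * c.eps T :=
      (sum_dist_le_of_sum_dist_le (fun i s => P.γmax i (x s)) (c.cγ * c.μ) (t - T) t _
        (fun a b ha hab hb => (hc.cγ_bound _ (hmem b (by linarith) hb) _
          (hmem a ha (by linarith))).trans (hstep hcγ ha hab hb))
        (fun i => P.time i (k t i)) t le_rfl (fun i _ => hσ i) (by linarith)).trans (hend hcγ)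
    -- The comparison state is `x t₁`, where `α ∘ h` vanishes and which is at most `μ T` away.
    have hα : -(c.cα * c.eps T) ≤ P.α (P.h (x t)) := by
      have h1 := hc.cα_bound _ hS1 _ (hS t ht0 ht'.le)
      rw [hzero, hP.α_classK.map_zero, zero_sub, abs_neg] at h1
      have h2 : ‖x t₁ - x t‖ ≤ c.eps T :=
        (hlip ht0 ht'.le le_rfl).trans
          ((mul_le_mul_of_nonneg_left (by linarith) hμ.le).trans hμT)
      linarith [neg_abs_le (P.α (P.h (x t))), mul_le_mul_of_nonneg_left h2 hcα]
    have hφ := (le_abs_self _).trans (hc.ch_bound _ (hS t ht0 ht'.le) t ht0)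
    have hG' := mul_le_mul_of_nonneg_right hG hc.umax_nonneg
    have hmain := hcond (x t) (hstrip t (by linarith) ht'.le)
    rw [η] at hmain
    linarith
  have hend := image_le_of_deriv_right_le_deriv_boundary hcont hderiv (B := fun _ => P.h (x (t₁ - T)))
    (B' := fun _ => 0) le_rfl continuousOn_const (fun t _ => hasDerivWithinAt_const _ _ _) hle
    (right_mem_Icc.2 (by linarith))
  linarith [hneg (t₁ - T) (by linarith) (by linarith)]

end MultiAgentSystem

theorem mainTheorem3 {ι E : Type*} {X U : ι → Type*} [Fintype ι] [DecidableEq ι] [Nonempty ι]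
    [NormedAddCommGroup E] [NormedSpace ℝ E]
    [∀ i, NormedAddCommGroup (X i)] [∀ i, NormedSpace ℝ (X i)] [∀ i, FiniteDimensional ℝ (X i)]
    [∀ i, NormedAddCommGroup (U i)] [∀ i, NormedSpace ℝ (U i)] [∀ i, FiniteDimensional ℝ (U i)]
    (P : MultiAgentSystem ι E X U) (hP : P.StandingAssumptions)
    (c : ErrorConstants) (hc : P.IsErrorConstants c)
    (εs : ℝ) (hεs : εs = c.eps P.horizon)
    (hcond : ∀ x ∈ P.innerStrip (2 * εs),
      ∑ i ∈ P.adversarialᶜ, sSup (P.γmin i '' (Metric.ball x εs ∩ P.safeSet))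
        + ∑ j ∈ P.adversarial, P.γmax j x + P.α (P.h x) ≤ - P.η c P.horizon) :
    ∀ (τ : ℝ) (x : ℝ → E) (u₀ : ∀ i, U i) (u : ∀ i, ℕ → U i),
      P.IsTrajectory τ x u₀ u →
      P.AdversariesMaximize τ x u →
      P.NormalAgentsMinimizeOn (P.innerStrip (2 * εs)) τ x u →
      x 0 ∈ P.safeSet \ P.innerStrip (2 * εs) →
      ∀ t ∈ Set.Ico 0 τ, x t ∈ P.safeSet := by

  intro τ x u₀ u hx hmax hmin hx0 t ht
  subst hεs
  by_contra hout
  have hout : 0 < P.h (x t) := not_le.1 hout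
  -- A boundary point is at distance zero from the boundary, hence in the strip because `ε* ≥ 0`.
  have hh0 : P.h (x 0) < 0 := lt_of_le_of_ne hx0.1 fun h => hx0.2 ⟨hx0.1, x 0, h, by
    have := c.mul_le_eps hc.μ_nonneg hc.L'_pos P.horizon
    have := mul_nonneg hc.μ_nonneg hP.horizon_pos.le
    rw [sub_self, norm_zero]
    linarith⟩
  have hcont : ContinuousOn (fun s => P.h (x s)) (Icc 0 t) :=
    hP.h_contDiff.continuous.comp_continuousOn
      (hx.continuousOn.mono fun s hs => ⟨hs.1, hs.2.trans_lt ht.2⟩)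
  obtain ⟨t₁, ⟨ht₁, hz⟩, hleast⟩ : ∃ t₁, IsLeast (Icc 0 t ∩ (fun s => P.h (x s)) ⁻¹' {0}) t₁ :=
    (isCompact_Icc.of_isClosed_subset (hcont.preimage_isClosed_of_isClosed isClosed_Icc
      isClosed_singleton) inter_subset_left).exists_isLeast
      (intermediate_value_Icc ht.1 hcont ⟨hh0.le, hout.le⟩)
  refine hx.h_ne_zero hP hc hcond hmax hmin hx0.2 ht₁.1 (ht₁.2.trans_lt ht.2) ?_ hz
  intro s hs hst
  -- Otherwise the intermediate value theorem yields a zero before the least one.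
  by_contra! hge
  obtain ⟨r, hr, hr0⟩ := intermediate_value_Icc hs
    (hcont.mono (Icc_subset_Icc_right (hst.le.trans ht₁.2))) ⟨hh0.le, hge⟩
  exact ((hr.2.trans_lt hst).trans_le
    (hleast ⟨⟨hr.1, hr.2.trans (hst.le.trans ht₁.2)⟩, hr0⟩)).false
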